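/- Let $X$ be a Polish space and let $T : X \to X$ be an aperiodic homeomorphism, i.e. $T^n x \neq x$ for all $x \in X$ and all integers $n \geq 1$. Then there exist a compact metric space $Y$, a homeomorphism $S : Y \to Y$, a dense $G_\delta$ subset $D \subseteq Y$ with $S(D) = D$, and a homeomorphism $F : X \to D$ (where $D$ carries the subspace topology) such that $F(Tx) = S(F(x))$ for all $x \in X$; that is, $T$ is conjugate by a homeomorphism to the restriction $S|_D$. -/

import Mathlib

/-- A self-map is aperiodic if no point satisfies `T^n x = x` for some `n ≥ 1`
(`Function.periodicPts T` is the set of the points that do). -/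
def IsAperiodic {X : Type*} (T : X → X) : Prop :=
  ∀ x : X, x ∉ Function.periodicPts T

/-!
Embed `X` in the Hilbert cube `Q` by a map `e`, and send `x` to its itinerary `n ↦ e (T ^ n x)`.
This embeds `X` in the compact metrizable space `ℤ → Q` and turns `T` into the shift. Take for `Y`
the closure of the image `D` of `X`. The image is a dense `Gδ` in `Y` because `X` is completely
metrizable: `D` consists of the points of `Y` whose neighbourhoods trace a Cauchy filter on `X`,
which is a countable intersection of open conditions.
-/

open Function Set Filter Topology TopologicalSpace Uniformity
open SymbolicDynamics.FullShift (shift continuous_shift)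

section DenseGδ

variable {X Y : Type*} [TopologicalSpace Y]

theorem isGδ_setOfPred_comap_nhds_prod_le_uniformity [UniformSpace X] [IsCountablyGenerated (𝓤 X)]
    (f : X → Y) : IsGδ {y | comap f (𝓝 y) ×ˢ comap f (𝓝 y) ≤ 𝓤 X} := by
  obtain ⟨U, hU⟩ := exists_antitone_basis (𝓤 X)
  have hbasis (y : Y) := ((nhds_basis_opens y).comap f).prod_self.le_basis_iff hU.toHasBasis
  simp only [hbasis, forall_const, ofPred_forall]
  refine .iInter_of_isOpen fun n => isOpen_iff_mem_nhds.2 ?_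
  rintro y ⟨V, ⟨hyV, hV⟩, hVU⟩
  filter_upwards [hV.mem_nhds hyV] with z hzV using ⟨V, ⟨hzV, hV⟩, hVU⟩

theorem range_eq_setOfPred_cauchy_comap_nhds [UniformSpace X] [CompleteSpace X] [T2Space Y]
    {f : X → Y} (hf : IsInducing f) : range f = {y | Cauchy (comap f (𝓝 y))} := by
  refine Subset.antisymm ?_ fun y hy => ?_
  · rintro _ ⟨x, rfl⟩
    rw [mem_ofPred_eq, ← hf.nhds_eq_comap]
    exact cauchy_nhds
  · obtain ⟨x, hx⟩ := CompleteSpace.complete hy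
    have := hy.1
    exact ⟨x, tendsto_nhds_unique ((hf.continuous.tendsto x).mono_left hx) tendsto_comap⟩

theorem isGδ_range_of_isDenseInducing [TopologicalSpace X] [IsCompletelyPseudoMetrizableSpace X]
    [T2Space Y] {f : X → Y} (hf : IsDenseInducing f) : IsGδ (range f) := by
  let := upgradeIsCompletelyPseudoMetrizable X
  rw [range_eq_setOfPred_cauchy_comap_nhds hf.isInducing]
  simpa only [Cauchy, hf.comap_nhds_neBot, true_and] using
    isGδ_setOfPred_comap_nhds_prod_le_uniformity f

end DenseGδ

section Itinerary

/-- The shift by `g` on configurations `G → Q`, as a homeomorphism for the product topology. -/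
def shiftHomeomorph {G : Type*} [AddGroup G] (Q : Type*) [TopologicalSpace Q] (g : G) :
    (G → Q) ≃ₜ (G → Q) where
  toFun := shift g
  invFun := shift (-g)
  left_inv z := by ext; simp
  right_inv z := by ext; simp
  continuous_toFun := continuous_shift g
  continuous_invFun := continuous_shift (-g)

variable {X Q : Type*} [TopologicalSpace X]

/-- The itinerary of `x` is its two-sided orbit under `T`, observed through the map `e`. -/
def itinerary (T : X ≃ₜ X) (e : X → Q) (x : X) : ℤ → Q :=
  fun n => e ((T ^ n) x)

variable [TopologicalSpace Q]

theorem semiconj_itinerary (T : X ≃ₜ X) (e : X → Q) :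
    Semiconj (itinerary T e) T (shiftHomeomorph Q (1 : ℤ)) := fun x => by
  funext n
  change e ((T ^ n * T) x) = e ((T ^ (1 + n)) x)
  rw [← zpow_add_one, add_comm]

theorem isEmbedding_itinerary (T : X ≃ₜ X) {e : X → Q} (he : IsEmbedding e) :
    IsEmbedding (itinerary T e) :=
  .of_comp (continuous_pi fun n => he.continuous.comp (T ^ n).continuous)
    (continuous_apply (0 : ℤ)) he

end Itinerary

theorem preimage_range_of_semiconj {α β : Type*} {f : α → β} {T : α → α} {S : β → β}
    (h : Semiconj f T S) (hT : Surjective T) (hS : Injective S) :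
    S ⁻¹' range f = range f :=
  ((preimage_mono (h.surjOn_range hT)).trans_eq (preimage_image_eq _ hS)).antisymm h.mapsTo_range

theorem exists_compact_isDenseEmbedding_semiconj {X : Type*} [TopologicalSpace X]
    [MetrizableSpace X] [SeparableSpace X] (T : X ≃ₜ X) :
    ∃ (Y : Type) (_ : MetricSpace Y) (_ : CompactSpace Y) (S : Y ≃ₜ Y) (f : X → Y),
      IsDenseEmbedding f ∧ Semiconj f T S := by
  let := metrizableSpaceMetric X
  obtain ⟨e, he⟩ := Metric.PiNatEmbed.exists_embedding_to_hilbert_cube (X := X)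
  let φ := itinerary T e
  let σ := shiftHomeomorph (ℕ → unitInterval) (1 : ℤ)
  have hφ : IsEmbedding φ := isEmbedding_itinerary T he
  have hφT : Semiconj φ T σ := semiconj_itinerary T e
  let K := closure (range φ)
  have hK : K = σ ⁻¹' K := by
    rw [σ.preimage_closure, preimage_range_of_semiconj hφT T.surjective σ.injective]
  let f : X → K := codRestrict φ K fun x => subset_closure (mem_range_self x)
  have hf : IsEmbedding f := hφ.codRestrict K _
  have hfdense : DenseRange f := Subtype.dense_iff.2 (closure_mono (range_comp Subtype.val f).le)
  exact ⟨K, metrizableSpaceMetric K, isCompact_iff_compactSpace.1 isClosed_closure.isCompact,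
    σ.sets hK, f, ⟨⟨hf.isInducing, hfdense⟩, hf.injective⟩, fun x => Subtype.ext (hφT x)⟩

theorem corollary4p6_general {X : Type*} [TopologicalSpace X] [PolishSpace X] (T : X ≃ₜ X) :
    ∃ (Y : Type) (_ : MetricSpace Y) (_ : CompactSpace Y) (S : Y ≃ₜ Y) (D : Set Y)
      (hD : ∀ y : Y, y ∈ D ↔ S y ∈ D),
      Dense D ∧ IsGδ D ∧
        ∃ F : X ≃ₜ D, ∀ x : X, F (T x) = (S.subtype hD : D ≃ₜ D) (F x) := by
  obtain ⟨Y, instMetric, instCompact, S, f, hf, hfT⟩ := exists_compact_isDenseEmbedding_semiconj T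
  have hD : S ⁻¹' range f = range f :=
    preimage_range_of_semiconj hfT T.surjective S.injective
  exact ⟨Y, instMetric, instCompact, S, range f, fun y => (Set.ext_iff.1 hD y).symm, hf.dense,
    isGδ_range_of_isDenseInducing hf.isDenseInducing, hf.isEmbedding.toHomeomorph,
    fun x => Subtype.ext (hfT x)⟩

theorem corollary4p6 {X : Type*} [TopologicalSpace X] [PolishSpace X] (T : X ≃ₜ X)
    (hT : IsAperiodic T) :
    ∃ (Y : Type) (_ : MetricSpace Y) (_ : CompactSpace Y) (S : Y ≃ₜ Y) (D : Set Y)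
      (hD : ∀ y : Y, y ∈ D ↔ S y ∈ D),
      Dense D ∧ IsGδ D ∧
        ∃ F : X ≃ₜ D, ∀ x : X, F (T x) = (S.subtype hD : D ≃ₜ D) (F x) :=
  corollary4p6_general T
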